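/- Let $k$ be a field and let $\mathcal{C}$ be a triangulated $k$-category with suspension functor $\Sigma$. Assume that $\mathcal{C}$ is $\operatorname{Hom}$-finite (all the spaces $\operatorname{Hom}_{\mathcal{C}}(X,Y)$ are finite-dimensional over $k$) and Krull–Schmidt (every object is a finite direct sum of objects with local endomorphism rings), and that it has Serre duality: there are a triangle autoequivalence $\nu\colon\mathcal{C}\to\mathcal{C}$ and $k$-linear isomorphisms $\operatorname{Hom}_{\mathcal{C}}(X,Y)\cong\operatorname{Hom}_k(\operatorname{Hom}_{\mathcal{C}}(Y,\nu X),k)$, functorial in $X$ and $Y$. Let $R$ be a rigid object of $\mathcal{C}$, that is, $\operatorname{Hom}_{\mathcal{C}}(R,\Sigma R)=0$, and let $\mathcal{X}_R=\operatorname{Ker}\operatorname{Hom}_{\mathcal{C}}(R,-)$ be the full subcategory of the objects $Y$ with $\operatorname{Hom}_{\mathcal{C}}(R,Y)=0$. Let $\mathcal{C}/[\mathcal{X}_R]$ be the additive quotient category, with the same objects as $\mathcal{C}$, and with morphisms those of $\mathcal{C}$ modulo the ideal $[\mathcal{X}_R]$ of the morphisms that factor through an object of $\mathcal{X}_R$.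 Then $\mathcal{C}/[\mathcal{X}_R]$ is quasi-abelian: it is an additive category in which every morphism has a kernel and a cokernel, the class of all cokernels is stable under pullback, and the class of all kernels is stable under pushout. -/

import Mathlib

open CategoryTheory CategoryTheory.Limits CategoryTheory.Pretriangulated
open scoped ZeroObject

universe w v u

namespace QuasiAbelianHearts

section QuasiAbelian

variable (A : Type u) [Category.{v} A]

/-- The class of all kernels in `A`: morphisms which are a kernel of some morphism. -/
def kernels [HasZeroMorphisms A] : MorphismProperty A := fun _ _ f => Nonempty (NormalMono f)

/-- The class of all cokernels in `A`: morphisms which are a cokernel of some morphism. -/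
def cokernels [HasZeroMorphisms A] : MorphismProperty A := fun _ _ f => Nonempty (NormalEpi f)

/-- A preabelian category: an additive category (preadditive, with all finite biproducts, hence
with a zero object) in which every morphism has a kernel and a cokernel. -/
structure IsPreabelian [Preadditive A] : Prop where
  hasFiniteBiproducts : HasFiniteBiproducts A
  hasKernels : HasKernels A
  hasCokernels : HasCokernels A

/-- A left quasi-abelian category: preabelian, and in every pullback square the morphism opposite
to a cokernel is a cokernel. -/
structure IsLeftQuasiAbelian [Preadditive A] : Prop extends IsPreabelian A where
  cokernels_stable : (cokernels A).IsStableUnderBaseChange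

/-- A right quasi-abelian category: preabelian, and in every pushout square the morphism opposite
to a kernel is a kernel. -/
structure IsRightQuasiAbelian [Preadditive A] : Prop extends IsPreabelian A where
  kernels_stable : (kernels A).IsStableUnderCobaseChange

/-- A quasi-abelian category: both left and right quasi-abelian. -/
structure IsQuasiAbelian [Preadditive A] : Prop extends
  IsLeftQuasiAbelian A, IsRightQuasiAbelian A

end QuasiAbelian

section AdditiveQuotient

variable {C : Type u} [Category.{v} C]

/-- The morphisms in the ideal `[P]`: those that factor through an object satisfying `P`. -/
def FactorsThrough (P : ObjectProperty C) {X Y : C} (f : X ⟶ Y) : Prop :=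
  ∃ (Z : C) (a : X ⟶ Z) (b : Z ⟶ Y), P Z ∧ a ≫ b = f

variable [Preadditive C]

/-- Congruence modulo the ideal `[P]`: two morphisms are identified when their difference factors
through an object satisfying `P`. -/
def idealRel (P : ObjectProperty C) : HomRel C := fun _ _ f g => FactorsThrough P (f - g)

lemma FactorsThrough.neg {P : ObjectProperty C} {X Y : C} {f : X ⟶ Y}
    (hf : FactorsThrough P f) : FactorsThrough P (-f) := by
  obtain ⟨Z, a, b, hZ, rfl⟩ := hf
  exact ⟨Z, -a, b, hZ, by simp⟩

lemma FactorsThrough.zero (P : ObjectProperty C) [HasFiniteBiproducts C]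
    [P.IsClosedUnderFiniteProducts] (X Y : C) : FactorsThrough P (0 : X ⟶ Y) := by
  exact ⟨0, 0, 0, P.prop_of_isTerminal _ (isZero_zero C).isTerminal, by simp⟩

lemma FactorsThrough.add {P : ObjectProperty C} [HasFiniteBiproducts C]
    [P.IsClosedUnderFiniteProducts] {X Y : C} {f g : X ⟶ Y} (hf : FactorsThrough P f)
    (hg : FactorsThrough P g) : FactorsThrough P (f + g) := by
  obtain ⟨Z, a, b, hZ, rfl⟩ := hf
  obtain ⟨Z', a', b', hZ', rfl⟩ := hg
  have : HasBinaryBiproducts C := hasBinaryBiproducts_of_finite_biproducts C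
  exact ⟨Z ⊞ Z', biprod.lift a a', biprod.desc b b',
    P.prop_of_isLimit_binaryFan (BinaryBiproduct.isLimit Z Z') hZ hZ', by
      simp⟩

instance idealRel_congruence (P : ObjectProperty C) [HasFiniteBiproducts C]
    [P.IsClosedUnderFiniteProducts] : Congruence (idealRel P) where
  comp_left := by
    rintro X Y Z f g g' ⟨W, a, b, hW, h⟩
    exact ⟨W, f ≫ a, b, hW, by simp [h]⟩
  comp_right := by
    rintro X Y Z f f' g ⟨W, a, b, hW, h⟩
    exact ⟨W, a, b ≫ g, hW, by rw [← Category.assoc, h, Preadditive.sub_comp]⟩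
  equivalence :=
    { refl := fun f => by
        simpa [idealRel] using FactorsThrough.zero P _ _
      symm := fun {f g} h => by
        simpa [idealRel] using FactorsThrough.neg h
      trans := fun {f g h} h₁ h₂ => by
        simpa [idealRel] using FactorsThrough.add h₁ h₂ }

/-- The additive quotient `C/[P]`: its objects are those of `C`, its morphisms are the morphisms
of `C` modulo those factoring through an object satisfying `P`. -/
abbrev AdditiveQuotient (P : ObjectProperty C) := Quotient (idealRel P)

/-- `C/[P]` is a preadditive category, with addition inherited from `C`. -/
instance additiveQuotientPreadditive (P : ObjectProperty C) [HasFiniteBiproducts C]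
    [P.IsClosedUnderFiniteProducts] : Preadditive (AdditiveQuotient P) :=
  Quotient.preadditive (idealRel P) (fun X Y f₁ f₂ g₁ g₂ hf hg => by
    have := FactorsThrough.add hf hg
    simpa [idealRel, add_sub_add_comm] using this)

end AdditiveQuotient

section HomKernel

variable {C : Type u} [Category.{v} C]

/-- `X_R = Ker Hom(R, -)`: the objects `Y` with `Hom(R, Y) = 0`. -/
def homKernel [HasZeroMorphisms C] (R : C) : ObjectProperty C := fun Y => ∀ f : R ⟶ Y, f = 0

instance homKernel_closed [HasZeroMorphisms C] (R : C) :
    (homKernel R).IsClosedUnderFiniteProducts where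
  isClosedUnderLimitsOfShape J _ :=
    { limitsOfShape_le := by
        rintro Y ⟨p⟩ f
        refine p.isLimit.hom_ext fun j => ?_
        rw [zero_comp]
        exact p.prop_diag_obj j _ }

/-- `R` is rigid: `Ext¹(R, R) = Hom(R, ΣR) = 0`. -/
def IsRigid [HasZeroMorphisms C] [HasShift C ℤ] (R : C) : Prop := ∀ f : R ⟶ R⟦(1 : ℤ)⟧, f = 0

end HomKernel

section Hypotheses

/-- Every morphism space is finite-dimensional over `k`. -/
def IsHomFinite (k : Type w) [Field k] (C : Type u) [Category.{v} C] [Preadditive C]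
    [Linear k C] : Prop :=
  ∀ X Y : C, FiniteDimensional k (X ⟶ Y)

/-- Every object is a finite direct sum of objects with local endomorphism rings. -/
def IsKrullSchmidt (C : Type u) [Category.{v} C] [Preadditive C] [HasFiniteBiproducts C] : Prop :=
  ∀ X : C, ∃ (n : ℕ) (Y : Fin n → C), (∀ i, IsLocalRing (End (Y i))) ∧ Nonempty (X ≅ ⨁ Y)

variable (k : Type w) [Field k] (C : Type u) [Category.{v} C] [Preadditive C] [Linear k C]
  [HasZeroObject C] [HasShift C ℤ] [∀ n : ℤ, (shiftFunctor C n).Additive] [Pretriangulated C]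

/-- A Serre functor: a triangle autoequivalence `ν` of `C` together with isomorphisms of
`k`-vector spaces `Hom(X, Y) ≅ D Hom(Y, νX)`, where `D` is the `k`-dual, functorial in `X` and
in `Y`. -/
structure SerreFunctor where
  ν : C ⥤ C
  isEquivalence : ν.IsEquivalence
  commShift : ν.CommShift ℤ
  isTriangulated : ν.IsTriangulated
  duality (X Y : C) : (X ⟶ Y) ≃ₗ[k] Module.Dual k (Y ⟶ ν.obj X)
  duality_naturality_left {X' X Y : C} (f : X' ⟶ X) (g : X ⟶ Y) (h : Y ⟶ ν.obj X') :
    duality X' Y (f ≫ g) h = duality X Y g (h ≫ ν.map f)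
  duality_naturality_right {X Y Y' : C} (f : X ⟶ Y) (g : Y ⟶ Y') (h : Y' ⟶ ν.obj X) :
    duality X Y' (f ≫ g) h = duality X Y f (g ≫ h)

/-- `C` has Serre duality if it admits a Serre functor. -/
def HasSerreDuality : Prop := Nonempty (SerreFunctor k C)

end Hypotheses

end QuasiAbelianHearts

/-! Let `Q` be the quotient functor. Since `R` is rigid and has right approximations `Rⁿ ⟶ X`, `Q`
kills `f` exactly when `Hom(R, f) = 0` (`factorsThrough_homKernel_iff`). By Serre duality this is
equivalent to `Hom(f, S) = 0` with `S = νR`, again rigid (`SerreFunctor.forall_comp_eq_zero_iff`,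
`SerreFunctor.isRigid_obj`). So `Q` loses nothing on morphisms out of `Rⁿ` or into `Sⁿ`.

The cone of a morphism out of `Rⁿ` is therefore a genuine cokernel in the quotient
(`exists_isColimit_cokernelCofork`). Precomposing with an approximation, which becomes epi, makes
every cokernel arise in this way. To pull such a cokernel back along `h`, complete `h ≫ d` to a
triangle, where `d` is the connecting morphism: the new middle object maps epimorphically onto the
pullback, which exhibits the pulled back morphism as a cokernel. Kernels and pushouts are treated
dually, with `S` in place of `R`. -/

namespace QuasiAbelianHearts

/-! ### Recognising kernels and cokernels. -/

section NormalMorphisms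

variable {A : Type*} [Category* A] [HasZeroMorphisms A]

/-- An epimorphism through which every morphism killed by `g` factors is a cokernel of `g`. -/
noncomputable def cokernelCoforkIsColimit {X Y Z : A} {g : X ⟶ Y} {p : Y ⟶ Z} (w : g ≫ p = 0)
    [Epi p] (h : ∀ {W : A} (t : Y ⟶ W), g ≫ t = 0 → ∃ l : Z ⟶ W, p ≫ l = t) :
    IsColimit (CokernelCofork.ofπ p w) :=
  CokernelCofork.IsColimit.ofπ' p w fun t ht => ⟨(h t ht).choose, (h t ht).choose_spec⟩

/-- A monomorphism through which every morphism killed by `g` factors is a kernel of `g`. -/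
noncomputable def kernelForkIsLimit {X Y Z : A} {i : X ⟶ Y} {g : Y ⟶ Z} (w : i ≫ g = 0)
    [Mono i] (h : ∀ {W : A} (t : W ⟶ Y), t ≫ g = 0 → ∃ l : W ⟶ X, l ≫ i = t) :
    IsLimit (KernelFork.ofι i w) :=
  KernelFork.IsLimit.ofι' i w fun t ht => ⟨(h t ht).choose, (h t ht).choose_spec⟩

end NormalMorphisms

/-! ### Approximations from finite-dimensional Hom spaces. -/

section Approximations

variable {C : Type*} [Category* C] [Preadditive C] [HasFiniteBiproducts C]

/-- Every object `X` has a right approximation `Rⁿ ⟶ X` through which every morphism `R ⟶ X`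
factors. -/
def HasRightApproximations (R : C) : Prop :=
  ∀ X : C, ∃ (n : ℕ) (a : (⨁ fun _ : Fin n => R) ⟶ X), ∀ r : R ⟶ X, ∃ s, s ≫ a = r

/-- Every object `X` has a left approximation `X ⟶ Sⁿ` through which every morphism `X ⟶ S`
factors. -/
def HasLeftApproximations (S : C) : Prop :=
  ∀ X : C, ∃ (n : ℕ) (a : X ⟶ (⨁ fun _ : Fin n => S)), ∀ s : X ⟶ S, ∃ t, a ≫ t = s

/-- The components of the approximation are a basis of `R ⟶ X`; the coordinates of `r` give its
factorization. -/
lemma IsHomFinite.hasRightApproximations {k : Type*} [Field k] [Linear k C]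
    (h : IsHomFinite k C) (R : C) : HasRightApproximations R := by
  intro X
  have := h R X
  let b := Module.finBasis k (R ⟶ X)
  refine ⟨_, biproduct.desc b, fun r => ⟨biproduct.lift fun i => b.repr r i • 𝟙 R, ?_⟩⟩
  rw [biproduct.lift_desc]
  simp [b.sum_repr]

lemma IsHomFinite.hasLeftApproximations {k : Type*} [Field k] [Linear k C]
    (h : IsHomFinite k C) (S : C) : HasLeftApproximations S := by
  intro X
  have := h X S
  let b := Module.finBasis k (X ⟶ S)
  refine ⟨_, biproduct.lift b, fun s => ⟨biproduct.desc fun i => b.repr s i • 𝟙 S, ?_⟩⟩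
  rw [biproduct.lift_desc]
  simp [b.sum_repr]

end Approximations

/-! ### Rigidity for finite sums of copies of `R`. -/

section Rigid

variable {C : Type*} [Category* C] [Preadditive C] [HasFiniteBiproducts C] [HasShift C ℤ] {R : C}

lemma IsRigid.eq_zero_from_biproduct (hR : IsRigid R) {n : ℕ}
    (f : (⨁ fun _ : Fin n => R) ⟶ R⟦(1 : ℤ)⟧) : f = 0 := by
  ext i
  simpa using hR _

lemma IsRigid.eq_zero_to_biproduct [∀ n : ℤ, (shiftFunctor C n).Additive] (hR : IsRigid R)
    {n : ℕ} (f : R ⟶ (⨁ fun _ : Fin n => R)⟦(1 : ℤ)⟧) : f = 0 := by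
  rw [← Category.comp_id f, ← (shiftFunctor C (1 : ℤ)).map_id, ← biproduct.total, Functor.map_sum,
    Preadditive.comp_sum]
  refine Finset.sum_eq_zero fun i _ => ?_
  rw [Functor.map_comp, ← Category.assoc, hR (f ≫ _), zero_comp]

end Rigid

/-! ### Functors whose vanishing is detected by `Hom(R, -)` or `Hom(-, S)`. -/

section DetectedByHom

variable {C : Type*} [Category* C] [Preadditive C] {A : Type*} [Category* A] [Preadditive A]
  {Q : C ⥤ A} {R S : C}

lemma eq_zero_of_map_eq_zero_of_source [HasFiniteBiproducts C]
    (hQ : ∀ {X Y : C} (f : X ⟶ Y), Q.map f = 0 ↔ ∀ r : R ⟶ X, r ≫ f = 0) {n : ℕ} {Y : C}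
    {f : (⨁ fun _ : Fin n => R) ⟶ Y} (hf : Q.map f = 0) : f = 0 := by
  ext i
  rw [comp_zero]
  exact (hQ f).1 hf _

lemma eq_zero_of_map_eq_zero_of_target [HasFiniteBiproducts C]
    (hQ : ∀ {X Y : C} (f : X ⟶ Y), Q.map f = 0 ↔ ∀ s : Y ⟶ S, f ≫ s = 0) {n : ℕ} {Y : C}
    {f : Y ⟶ (⨁ fun _ : Fin n => S)} (hf : Q.map f = 0) : f = 0 := by
  ext i
  rw [zero_comp]
  exact (hQ f).1 hf _

variable [Q.Full]

/-- `Q` is faithful on morphisms out of `R`: taking `𝟙 R` as the test morphism in `hQ` turns a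
vanishing in `A` into one in `C`. Stated in `A`, so that it applies to morphisms into a pullback. -/
lemma epi_of_surjective_hom (hobj : Function.Surjective Q.obj)
    (hQ : ∀ {X Y : C} (f : X ⟶ Y), Q.map f = 0 ↔ ∀ r : R ⟶ X, r ≫ f = 0) {X Y : A} (f : X ⟶ Y)
    (hf : ∀ r : Q.obj R ⟶ Y, ∃ s, s ≫ f = r) : Epi f := by
  refine Preadditive.epi_of_cancel_zero f fun {W} t ht => ?_
  obtain ⟨Y, rfl⟩ := hobj Y
  obtain ⟨W, rfl⟩ := hobj W
  obtain ⟨t, rfl⟩ := Q.map_surjective t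
  rw [hQ]
  intro r
  obtain ⟨s, hs⟩ := hf (Q.map r)
  have h0 : Q.map (r ≫ t) = 0 := by rw [Q.map_comp, ← hs, Category.assoc, ht, comp_zero]
  simpa using (hQ _).1 h0 (𝟙 R)

lemma epi_map_of_surjective_hom (hobj : Function.Surjective Q.obj)
    (hQ : ∀ {X Y : C} (f : X ⟶ Y), Q.map f = 0 ↔ ∀ r : R ⟶ X, r ≫ f = 0) {X Y : C} (f : X ⟶ Y)
    (hf : ∀ r : R ⟶ Y, ∃ s, s ≫ f = r) : Epi (Q.map f) := by
  refine epi_of_surjective_hom hobj hQ _ fun r => ?_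
  obtain ⟨r, rfl⟩ := Q.map_surjective r
  obtain ⟨s, rfl⟩ := hf r
  exact ⟨Q.map s, by simp⟩

lemma mono_of_surjective_hom (hobj : Function.Surjective Q.obj)
    (hQ : ∀ {X Y : C} (f : X ⟶ Y), Q.map f = 0 ↔ ∀ s : Y ⟶ S, f ≫ s = 0) {X Y : A} (f : X ⟶ Y)
    (hf : ∀ s : X ⟶ Q.obj S, ∃ t, f ≫ t = s) : Mono f := by
  refine Preadditive.mono_of_cancel_zero f fun {W} t ht => ?_
  obtain ⟨X, rfl⟩ := hobj X
  obtain ⟨W, rfl⟩ := hobj W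
  obtain ⟨t, rfl⟩ := Q.map_surjective t
  rw [hQ]
  intro s
  obtain ⟨l, hl⟩ := hf (Q.map s)
  have h0 : Q.map (t ≫ s) = 0 := by
    rw [Q.map_comp, ← hl, ← Category.assoc, ht, zero_comp]
  simpa using (hQ _).1 h0 (𝟙 S)

lemma mono_map_of_surjective_hom (hobj : Function.Surjective Q.obj)
    (hQ : ∀ {X Y : C} (f : X ⟶ Y), Q.map f = 0 ↔ ∀ s : Y ⟶ S, f ≫ s = 0) {X Y : C} (f : X ⟶ Y)
    (hf : ∀ s : X ⟶ S, ∃ t, f ≫ t = s) : Mono (Q.map f) := by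
  refine mono_of_surjective_hom hobj hQ _ fun s => ?_
  obtain ⟨s, rfl⟩ := Q.map_surjective s
  obtain ⟨t, rfl⟩ := hf s
  exact ⟨Q.map t, by simp⟩

end DetectedByHom

/-! ### Cokernels in the quotient and their pullbacks. -/

section RightRigid

variable {C : Type*} [Category* C] [Preadditive C] [HasZeroObject C] [HasShift C ℤ]
  [∀ n : ℤ, (shiftFunctor C n).Additive] [Pretriangulated C]
  {A : Type*} [Category* A] [Preadditive A] {Q : C ⥤ A} [Q.Full] [Q.Additive] {R : C}

/-- The cone of a morphism from `Rⁿ` is a cokernel in the quotient. -/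
lemma exists_isColimit_cokernelCofork (hobj : Function.Surjective Q.obj)
    (hQ : ∀ {X Y : C} (f : X ⟶ Y), Q.map f = 0 ↔ ∀ r : R ⟶ X, r ≫ f = 0) (hR : IsRigid R)
    {n : ℕ} {Y Z : C} {a : (⨁ fun _ : Fin n => R) ⟶ Y} {p : Y ⟶ Z} {d : Z ⟶ _}
    (hT : Triangle.mk a p d ∈ distTriang C) :
    ∃ w : Q.map a ≫ Q.map p = 0, Nonempty (IsColimit (CokernelCofork.ofπ (Q.map p) w)) := by
  have hap : a ≫ p = 0 := comp_distTriang_mor_zero₁₂ _ hT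
  -- The obstruction to lifting `R ⟶ Z` along `p` lies in `Hom(R, ΣRⁿ) = 0`.
  have : Epi (Q.map p) := epi_map_of_surjective_hom hobj hQ p fun r => by
    obtain ⟨s, hs⟩ := Triangle.coyoneda_exact₃ _ hT r (hR.eq_zero_to_biproduct _)
    exact ⟨s, hs.symm⟩
  refine ⟨by rw [← Q.map_comp, hap, Q.map_zero], ⟨cokernelCoforkIsColimit _ fun {W} t ht => ?_⟩⟩
  obtain ⟨W, rfl⟩ := hobj W
  obtain ⟨t, rfl⟩ := Q.map_surjective t
  obtain ⟨l, hl⟩ : ∃ l : Z ⟶ W, t = p ≫ l := Triangle.yoneda_exact₂ _ hT t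
    (eq_zero_of_map_eq_zero_of_source hQ ((Q.map_comp a t).trans ht))
  exact ⟨Q.map l, by rw [← Q.map_comp, hl]⟩

lemma hasCokernels_of_rightApproximations (hobj : Function.Surjective Q.obj)
    (hQ : ∀ {X Y : C} (f : X ⟶ Y), Q.map f = 0 ↔ ∀ r : R ⟶ X, r ≫ f = 0) (hR : IsRigid R)
    (happ : HasRightApproximations R) : HasCokernels A where
  has_colimit {X Y} f := by
    obtain ⟨X, rfl⟩ := hobj X
    obtain ⟨Y, rfl⟩ := hobj Y
    obtain ⟨f, rfl⟩ := Q.map_surjective f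
    -- As `Q.map a` is epi, replacing `f` by `a ≫ f` does not change the cokernel, but makes the
    -- source `Rⁿ`.
    obtain ⟨n, a, ha⟩ := happ X
    obtain ⟨Z, p, d, hT⟩ := distinguished_cocone_triangle (a ≫ f)
    obtain ⟨w, ⟨hc⟩⟩ := exists_isColimit_cokernelCofork hobj hQ hR hT
    have := epi_map_of_surjective_hom hobj hQ a ha
    have w' : Q.map f ≫ Q.map p = 0 := by
      rw [← cancel_epi (Q.map a), comp_zero, ← w, Q.map_comp, Category.assoc]
    have : Epi (Q.map p) := Cofork.IsColimit.epi hc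
    exact ⟨_, cokernelCoforkIsColimit w' fun t ht =>
      ⟨hc.desc (CokernelCofork.ofπ t (by rw [Q.map_comp, Category.assoc, ht, comp_zero])),
        hc.fac _ WalkingParallelPair.one⟩⟩

lemma cokernels_isStableUnderBaseChange (hobj : Function.Surjective Q.obj)
    (hQ : ∀ {X Y : C} (f : X ⟶ Y), Q.map f = 0 ↔ ∀ r : R ⟶ X, r ≫ f = 0) (hR : IsRigid R)
    (happ : HasRightApproximations R) : (cokernels A).IsStableUnderBaseChange where
  of_isPullback {E Y K Z f g f' g'} sq hg := by
    obtain ⟨W, w, hw, hcw⟩ := hg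
    obtain ⟨W, rfl⟩ := hobj W
    obtain ⟨Y, rfl⟩ := hobj Y
    obtain ⟨E, rfl⟩ := hobj E
    obtain ⟨w, rfl⟩ := Q.map_surjective w
    obtain ⟨n, a, ha⟩ := happ W
    have := epi_map_of_surjective_hom hobj hQ a ha
    obtain ⟨Z', p, d, hT⟩ := distinguished_cocone_triangle (a ≫ w)
    obtain ⟨haw, ⟨hc⟩⟩ := exists_isColimit_cokernelCofork hobj hQ hR hT
    have : Epi (Q.map p) := Cofork.IsColimit.epi hc
    have : Epi g := Cofork.IsColimit.epi hcw
    -- `g` and `Q.map p` are cokernels of morphisms differing by the epi `Q.map a`, so `φ` and `ψ`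
    -- compare them.
    obtain ⟨φ, hφ⟩ : ∃ φ : Q.obj Z' ⟶ Z, Q.map p ≫ φ = g :=
      ⟨hc.desc (CokernelCofork.ofπ g (by rw [Q.map_comp, Category.assoc, hw, comp_zero])),
        hc.fac _ WalkingParallelPair.one⟩
    obtain ⟨ψ, hψ⟩ : ∃ ψ : Z ⟶ Q.obj Z', g ≫ ψ = Q.map p :=
      ⟨hcw.desc (CokernelCofork.ofπ (Q.map p) (by
          rw [← cancel_epi (Q.map a), comp_zero, ← haw, Q.map_comp, Category.assoc])),
        hcw.fac _ WalkingParallelPair.one⟩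
    have hψφ : ψ ≫ φ = 𝟙 Z := by
      rw [← cancel_epi g, ← Category.assoc, hψ, hφ, Category.comp_id]
    obtain ⟨h, hh⟩ := Q.map_surjective (f ≫ ψ)
    -- `P` serves as a homotopy pullback of `p` along `h`.
    obtain ⟨P, a', p', hT'⟩ := distinguished_cocone_triangle₂ (h ≫ d)
    obtain ⟨y, hy₁, hy₂⟩ : ∃ y : P ⟶ Y, a' ≫ y = 𝟙 _ ≫ a ≫ w ∧ p' ≫ h = y ≫ p :=
      complete_distinguished_triangle_morphism₂ _ _ hT' hT (𝟙 _) h (by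
        change (h ≫ d) ≫ (shiftFunctor C (1 : ℤ)).map (𝟙 (⨁ fun _ : Fin n => R)) = h ≫ d
        rw [(shiftFunctor C (1 : ℤ)).map_id, Category.comp_id])
    rw [Category.id_comp] at hy₁
    obtain ⟨ha'p', ⟨hc'⟩⟩ := exists_isColimit_cokernelCofork hobj hQ hR hT'
    have hp' : Epi (Q.map p') := Cofork.IsColimit.epi hc'
    have comm : Q.map y ≫ g = Q.map p' ≫ f := by
      rw [← hφ, ← Category.assoc, ← Q.map_comp, ← hy₂, Q.map_comp, hh]
      simp [hψφ]
    let q := sq.lift _ _ comm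
    have hq₁ : q ≫ f' = Q.map y := sq.lift_fst _ _ _
    have hq₂ : q ≫ g' = Q.map p' := sq.lift_snd _ _ _
    have : Epi g' := by
      rw [← hq₂] at hp'
      exact epi_of_epi q g'
    have : Epi q := by
      -- A morphism from `R` to the pullback is a pair `s`, `t` that agrees already in `C`. Lift `t`
      -- to `u : R ⟶ P`; the error `s - u ≫ y` factors through `a ≫ w = a' ≫ y`, so adding `c ≫ a'`
      -- repairs it without changing the composite with `p'`.
      refine epi_of_surjective_hom hobj hQ q fun r => ?_
      obtain ⟨s, hs⟩ := Q.map_surjective (r ≫ f')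
      obtain ⟨t, ht⟩ := Q.map_surjective (r ≫ g')
      have hst : s ≫ p = t ≫ h := by
        have : Q.map (s ≫ p - t ≫ h) = 0 := by
          rw [Q.map_sub, Q.map_comp, Q.map_comp, hs, ht, hh, ← hψ, sub_eq_zero]
          simp only [Category.assoc, sq.w_assoc]
        simpa [sub_eq_zero] using (hQ _).1 this (𝟙 R)
      obtain ⟨u, hu⟩ : ∃ u : R ⟶ P, t = u ≫ p' := Triangle.coyoneda_exact₃ _ hT' t (by
        have hpd : p ≫ d = 0 := comp_distTriang_mor_zero₂₃ _ hT
        change t ≫ h ≫ d = 0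
        rw [← Category.assoc, ← hst, Category.assoc, hpd, comp_zero])
      obtain ⟨c, hc₀⟩ : ∃ c, s - u ≫ y = c ≫ a ≫ w :=
        Triangle.coyoneda_exact₂ _ hT (s - u ≫ y) (by
        change (s - u ≫ y) ≫ p = 0
        rw [Preadditive.sub_comp, Category.assoc, ← hy₂, hst, hu, Category.assoc, sub_self])
      have ha'p'₀ : a' ≫ p' = 0 := comp_distTriang_mor_zero₁₂ _ hT'
      refine ⟨Q.map (u + c ≫ a'), sq.hom_ext ?_ ?_⟩
      · rw [Category.assoc, hq₁, ← hs, ← Q.map_comp, Preadditive.add_comp, Category.assoc, hy₁,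
          ← hc₀, add_sub_cancel]
      · rw [Category.assoc, hq₂, ← ht, ← Q.map_comp, Preadditive.add_comp, Category.assoc, ha'p'₀,
          comp_zero, add_zero, hu]
    -- If `t` is killed by `Q.map a' ≫ q`, then `q ≫ t` descends along `Q.map p' = q ≫ g'`, and the
    -- epi `q` cancels.
    refine ⟨_, Q.map a' ≫ q, by rw [Category.assoc, hq₂, ha'p'], cokernelCoforkIsColimit _
      fun t ht => ?_⟩
    have hl : Q.map p' ≫ hc'.desc (CokernelCofork.ofπ (q ≫ t) (by rw [← Category.assoc, ht])) =
      q ≫ t := hc'.fac _ WalkingParallelPair.one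
    exact ⟨_, by rw [← cancel_epi q, ← Category.assoc, hq₂, hl]⟩

end RightRigid

/-! ### Kernels in the quotient and their pushouts. -/

section LeftRigid

variable {C : Type*} [Category* C] [Preadditive C] [HasZeroObject C] [HasShift C ℤ]
  [∀ n : ℤ, (shiftFunctor C n).Additive] [Pretriangulated C]
  {A : Type*} [Category* A] [Preadditive A] {Q : C ⥤ A} [Q.Full] [Q.Additive] {S : C}

/-- Morphisms to a rigid object `S` extend along the fibre of a morphism to `Sⁿ`. -/
lemma IsRigid.exists_extension (hS : IsRigid S) {n : ℕ} {X Y : C} {i : X ⟶ Y}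
    {b : Y ⟶ (⨁ fun _ : Fin n => S)} {d : _ ⟶ X⟦(1 : ℤ)⟧}
    (hT : Triangle.mk i b d ∈ distTriang C) (s : X ⟶ S) : ∃ t : Y ⟶ S, i ≫ t = s := by
  -- The obstruction `d ≫ s⟦1⟧'` lies in `Hom(Sⁿ, ΣS) = 0`. Rotating twice introduces the sign that
  -- `preimage (-t)` removes.
  obtain ⟨t, ht⟩ : ∃ t : Y⟦(1 : ℤ)⟧ ⟶ S⟦(1 : ℤ)⟧, s⟦(1 : ℤ)⟧' = (-i⟦(1 : ℤ)⟧') ≫ t :=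
    Triangle.yoneda_exact₂ _ (rot_of_distTriang _ (rot_of_distTriang _ hT)) (s⟦(1 : ℤ)⟧')
      (hS.eq_zero_from_biproduct (d ≫ s⟦(1 : ℤ)⟧'))
  refine ⟨(shiftFunctor C (1 : ℤ)).preimage (-t), (shiftFunctor C (1 : ℤ)).map_injective ?_⟩
  rw [ht, Functor.map_comp, Functor.map_preimage, Preadditive.comp_neg, Preadditive.neg_comp]

/-- The fibre of a morphism to `Sⁿ` is a kernel in the quotient. -/
lemma exists_isLimit_kernelFork (hobj : Function.Surjective Q.obj)
    (hQ : ∀ {X Y : C} (f : X ⟶ Y), Q.map f = 0 ↔ ∀ s : Y ⟶ S, f ≫ s = 0) (hS : IsRigid S)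
    {n : ℕ} {X Y : C} {i : X ⟶ Y} {b : Y ⟶ (⨁ fun _ : Fin n => S)} {d : _ ⟶ X⟦(1 : ℤ)⟧}
    (hT : Triangle.mk i b d ∈ distTriang C) :
    ∃ w : Q.map i ≫ Q.map b = 0, Nonempty (IsLimit (KernelFork.ofι (Q.map i) w)) := by
  have hib : i ≫ b = 0 := comp_distTriang_mor_zero₁₂ _ hT
  have : Mono (Q.map i) := mono_map_of_surjective_hom hobj hQ i (hS.exists_extension hT)
  refine ⟨by rw [← Q.map_comp, hib, Q.map_zero], ⟨kernelForkIsLimit _ fun {W} t ht => ?_⟩⟩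
  obtain ⟨W, rfl⟩ := hobj W
  obtain ⟨t, rfl⟩ := Q.map_surjective t
  obtain ⟨l, hl⟩ : ∃ l : W ⟶ X, t = l ≫ i := Triangle.coyoneda_exact₂ _ hT t
    (eq_zero_of_map_eq_zero_of_target hQ ((Q.map_comp t b).trans ht))
  exact ⟨Q.map l, by rw [← Q.map_comp, hl]⟩

lemma hasKernels_of_leftApproximations (hobj : Function.Surjective Q.obj)
    (hQ : ∀ {X Y : C} (f : X ⟶ Y), Q.map f = 0 ↔ ∀ s : Y ⟶ S, f ≫ s = 0) (hS : IsRigid S)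
    (happ : HasLeftApproximations S) : HasKernels A where
  has_limit {X Y} f := by
    obtain ⟨X, rfl⟩ := hobj X
    obtain ⟨Y, rfl⟩ := hobj Y
    obtain ⟨f, rfl⟩ := Q.map_surjective f
    obtain ⟨n, a, ha⟩ := happ Y
    obtain ⟨Z, i, d, hT⟩ := distinguished_cocone_triangle₁ (f ≫ a)
    obtain ⟨w, ⟨hc⟩⟩ := exists_isLimit_kernelFork hobj hQ hS hT
    have := mono_map_of_surjective_hom hobj hQ a ha
    have w' : Q.map i ≫ Q.map f = 0 := by
      rw [← cancel_mono (Q.map a), zero_comp, ← w, Q.map_comp, Category.assoc]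
    have : Mono (Q.map i) := Fork.IsLimit.mono hc
    exact ⟨_, kernelForkIsLimit w' fun t ht =>
      ⟨hc.lift (KernelFork.ofι t (by rw [Q.map_comp, ← Category.assoc, ht, zero_comp])),
        hc.fac _ WalkingParallelPair.zero⟩⟩

lemma kernels_isStableUnderCobaseChange (hobj : Function.Surjective Q.obj)
    (hQ : ∀ {X Y : C} (f : X ⟶ Y), Q.map f = 0 ↔ ∀ s : Y ⟶ S, f ≫ s = 0) (hS : IsRigid S)
    (happ : HasLeftApproximations S) : (kernels A).IsStableUnderCobaseChange where
  of_isPushout {X Y E K f g f' g'} sq hf := by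
    obtain ⟨W, w, hw, hcw⟩ := hf
    obtain ⟨W, rfl⟩ := hobj W
    obtain ⟨Y, rfl⟩ := hobj Y
    obtain ⟨E, rfl⟩ := hobj E
    obtain ⟨w, rfl⟩ := Q.map_surjective w
    obtain ⟨n, a, ha⟩ := happ W
    have := mono_map_of_surjective_hom hobj hQ a ha
    obtain ⟨Z', i, d, hT⟩ := distinguished_cocone_triangle₁ (w ≫ a)
    obtain ⟨haw, ⟨hc⟩⟩ := exists_isLimit_kernelFork hobj hQ hS hT
    have : Mono (Q.map i) := Fork.IsLimit.mono hc
    have : Mono f := Fork.IsLimit.mono hcw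
    obtain ⟨φ, hφ⟩ : ∃ φ : X ⟶ Q.obj Z', φ ≫ Q.map i = f :=
      ⟨hc.lift (KernelFork.ofι f (by rw [Q.map_comp, ← Category.assoc, hw, zero_comp])),
        hc.fac _ WalkingParallelPair.zero⟩
    obtain ⟨ψ, hψ⟩ : ∃ ψ : Q.obj Z' ⟶ X, ψ ≫ f = Q.map i :=
      ⟨hcw.lift (KernelFork.ofι (Q.map i) (by
          rw [← cancel_mono (Q.map a), zero_comp, ← haw, Q.map_comp, Category.assoc])),
        hcw.fac _ WalkingParallelPair.zero⟩
    have hφψ : φ ≫ ψ = 𝟙 X := by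
      rw [← cancel_mono f, Category.assoc, hψ, hφ, Category.id_comp]
    obtain ⟨h, hh⟩ := Q.map_surjective (ψ ≫ g)
    -- `P` serves as a homotopy pushout of `i` along `h`.
    obtain ⟨P, i', a', hT'⟩ := distinguished_cocone_triangle₂ (d ≫ h⟦(1 : ℤ)⟧')
    obtain ⟨y, hy₁, hy₂⟩ : ∃ y : Y ⟶ P, i ≫ y = h ≫ i' ∧ (w ≫ a) ≫ 𝟙 _ = y ≫ a' :=
      complete_distinguished_triangle_morphism₂ _ _ hT hT' h (𝟙 _)
        (Category.id_comp (d ≫ h⟦(1 : ℤ)⟧')).symm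
    rw [Category.comp_id] at hy₂
    obtain ⟨hi'a', ⟨hc'⟩⟩ := exists_isLimit_kernelFork hobj hQ hS hT'
    have hi' : Mono (Q.map i') := Fork.IsLimit.mono hc'
    have comm : g ≫ Q.map i' = f ≫ Q.map y := by
      rw [← hφ, Category.assoc, ← Q.map_comp, hy₁, Q.map_comp, hh, Category.assoc,
        reassoc_of% hφψ]
    let q := sq.desc _ _ comm
    have hq₁ : f' ≫ q = Q.map i' := sq.inl_desc _ _ _
    have hq₂ : g' ≫ q = Q.map y := sq.inr_desc _ _ _
    have : Mono f' := by
      rw [← hq₁] at hi'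
      exact mono_of_mono f' q
    have : Mono q := by
      -- Extend `s` to `u : P ⟶ S` by rigidity; the error `t - y ≫ u` factors through `w ≫ a = y ≫
      -- a'`, and the correction `a' ≫ c` vanishes after `i'`.
      refine mono_of_surjective_hom hobj hQ q fun r => ?_
      obtain ⟨s, hs⟩ := Q.map_surjective (f' ≫ r)
      obtain ⟨t, ht⟩ := Q.map_surjective (g' ≫ r)
      have hst : i ≫ t = h ≫ s := by
        have : Q.map (i ≫ t - h ≫ s) = 0 := by
          rw [Q.map_sub, Q.map_comp, Q.map_comp, hs, ht, hh, ← hψ, sub_eq_zero]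
          simp only [Category.assoc, sq.w_assoc]
        simpa [sub_eq_zero] using (hQ _).1 this (𝟙 S)
      obtain ⟨u, hu⟩ := hS.exists_extension hT' s
      obtain ⟨c, hc₀⟩ : ∃ c, t - y ≫ u = (w ≫ a) ≫ c :=
        Triangle.yoneda_exact₂ _ hT (t - y ≫ u) (by
          change i ≫ (t - y ≫ u) = 0
          rw [Preadditive.comp_sub, ← Category.assoc, hy₁, hst, Category.assoc, hu, sub_self])
      have hi'a'₀ : i' ≫ a' = 0 := comp_distTriang_mor_zero₁₂ _ hT'
      refine ⟨Q.map (u + a' ≫ c), sq.hom_ext ?_ ?_⟩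
      · rw [← Category.assoc, hq₁, ← hs, ← Q.map_comp, Preadditive.comp_add, ← Category.assoc,
          hi'a'₀, zero_comp, add_zero, hu]
      · rw [← Category.assoc, hq₂, ← ht, ← Q.map_comp, Preadditive.comp_add, ← Category.assoc,
          ← hy₂, ← hc₀, add_sub_cancel]
    refine ⟨_, q ≫ Q.map a', by rw [← Category.assoc, hq₁, hi'a'], kernelForkIsLimit _
      fun t ht => ?_⟩
    have hl : hc'.lift (KernelFork.ofι (t ≫ q) (by rw [Category.assoc, ht])) ≫ Q.map i' =
      t ≫ q := hc'.fac _ WalkingParallelPair.zero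
    exact ⟨_, by rw [← cancel_mono q, Category.assoc, hq₁, hl]⟩

end LeftRigid

/-! ### The quotient by `[X_R]` and the passage to `νR`. -/

section HomKernelQuotient

variable {C : Type*} [Category* C] [Preadditive C]

instance (P : ObjectProperty C) [HasFiniteBiproducts C] [P.IsClosedUnderFiniteProducts] :
    (Quotient.functor (idealRel P)).Additive :=
  Quotient.functor_additive _ _

lemma quotient_functor_map_eq_zero_iff (P : ObjectProperty C) [HasFiniteBiproducts C]
    [P.IsClosedUnderFiniteProducts] {X Y : C} (f : X ⟶ Y) :
    (Quotient.functor (idealRel P)).map f = 0 ↔ FactorsThrough P f := by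
  rw [← (Quotient.functor (idealRel P)).map_zero X Y, Quotient.functor_map_eq_iff, idealRel,
    sub_zero]

lemma quotient_functor_obj_surjective (P : ObjectProperty C) :
    Function.Surjective (Quotient.functor (idealRel P)).obj :=
  fun X => ⟨X.as, rfl⟩

lemma hasFiniteBiproducts_additiveQuotient (P : ObjectProperty C) [HasFiniteBiproducts C]
    [P.IsClosedUnderFiniteProducts] : HasFiniteBiproducts (AdditiveQuotient P) where
  out _ :=
    { has_biproduct := fun F =>
        (Quotient.functor (idealRel P)).hasBiproduct_of_preserves fun j => (F j).as }

variable [HasZeroObject C] [HasShift C ℤ] [∀ n : ℤ, (shiftFunctor C n).Additive]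
  [Pretriangulated C] {R : C}

/-- If `R` is rigid, the ideal `[X_R]` is the kernel of the functor `Hom(R, -)`. -/
lemma factorsThrough_homKernel_iff (hR : IsRigid R) (happ : HasRightApproximations R) {X Y : C}
    (f : X ⟶ Y) : FactorsThrough (homKernel R) f ↔ ∀ r : R ⟶ X, r ≫ f = 0 := by
  constructor
  · rintro ⟨Z, a, b, hZ, rfl⟩ r
    rw [← Category.assoc, hZ (r ≫ a), zero_comp]
  · intro hf
    obtain ⟨n, a, ha⟩ := happ X
    -- The cone `U` of the approximation lies in `X_R`: by rigidity any `R ⟶ U` lifts to `X`, hence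
    -- factors through `a`, which `p` kills. And `f`, killed by `a`, factors through `U`.
    obtain ⟨U, p, d, hT⟩ := distinguished_cocone_triangle a
    have hap : a ≫ p = 0 := comp_distTriang_mor_zero₁₂ _ hT
    obtain ⟨l, hl⟩ : ∃ l : U ⟶ Y, f = p ≫ l := Triangle.yoneda_exact₂ _ hT f (by
      change a ≫ f = 0
      ext i
      rw [comp_zero, ← Category.assoc]
      exact hf _)
    refine ⟨U, p, l, fun r => ?_, hl.symm⟩
    obtain ⟨s, hs⟩ : ∃ s : R ⟶ X, r = s ≫ p :=
      Triangle.coyoneda_exact₃ _ hT r (hR.eq_zero_to_biproduct _)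
    obtain ⟨t, rfl⟩ := ha s
    rw [hs, Category.assoc, hap, comp_zero]

namespace SerreFunctor

variable {k : Type*} [Field k] [Linear k C] (F : SerreFunctor k C)

/-- By Serre duality, `Hom(R, f) = 0` if and only if `Hom(f, νR) = 0`. -/
lemma forall_comp_eq_zero_iff (R : C) {X Y : C} (f : X ⟶ Y) :
    (∀ r : R ⟶ X, r ≫ f = 0) ↔ ∀ s : Y ⟶ F.ν.obj R, f ≫ s = 0 := by
  constructor
  · intro hf s
    -- Every functional on `X ⟶ νR` is represented by some `r : R ⟶ X`, and naturality moves `f`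
    -- across the pairing.
    rw [← Module.forall_dual_apply_eq_zero_iff k]
    intro φ
    obtain ⟨r, rfl⟩ := (F.duality R X).surjective φ
    rw [← F.duality_naturality_right, hf, map_zero, LinearMap.zero_apply]
  · intro hf r
    apply (F.duality R Y).injective
    ext s
    rw [F.duality_naturality_right, hf, map_zero, map_zero, LinearMap.zero_apply]

/-- `ν` is full and commutes with the shift, so morphisms `νR ⟶ ΣνR` come from morphisms `R ⟶ ΣR`.
-/
lemma isRigid_obj (hR : IsRigid R) : IsRigid (F.ν.obj R) := by
  have := F.isEquivalence
  have := F.commShift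
  have := F.isTriangulated
  intro f
  obtain ⟨g, hg⟩ := F.ν.map_surjective (f ≫ (F.ν.commShiftIso (1 : ℤ)).inv.app R)
  rw [← cancel_mono ((F.ν.commShiftIso (1 : ℤ)).inv.app R), ← hg, hR g, F.ν.map_zero, zero_comp]

end SerreFunctor

end HomKernelQuotient

end QuasiAbelianHearts

theorem theorem5p4 {k : Type w} [Field k] {C : Type u} [Category.{v} C] [Preadditive C]
    [Linear k C] [HasZeroObject C] [HasShift C ℤ] [∀ n : ℤ, (shiftFunctor C n).Additive]
    [∀ n : ℤ, (shiftFunctor C n).Linear k] [Pretriangulated C] [IsTriangulated C]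
    (hfin : QuasiAbelianHearts.IsHomFinite k C)
    (hKS : QuasiAbelianHearts.IsKrullSchmidt C)
    (hSerre : QuasiAbelianHearts.HasSerreDuality k C)
    (R : C) (hR : QuasiAbelianHearts.IsRigid R) :
    QuasiAbelianHearts.IsQuasiAbelian
      (QuasiAbelianHearts.AdditiveQuotient (QuasiAbelianHearts.homKernel R)) := by
  obtain ⟨F⟩ := hSerre
  have hRapp := hfin.hasRightApproximations R
  have hSapp := hfin.hasLeftApproximations (F.ν.obj R)
  have hS := F.isRigid_obj hR
  have hobj := QuasiAbelianHearts.quotient_functor_obj_surjective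
    (QuasiAbelianHearts.homKernel R)
  have hQR {X Y : C} (f : X ⟶ Y) :=
    (QuasiAbelianHearts.quotient_functor_map_eq_zero_iff _ f).trans
      (QuasiAbelianHearts.factorsThrough_homKernel_iff hR hRapp f)
  have hQS {X Y : C} (f : X ⟶ Y) := (hQR f).trans (F.forall_comp_eq_zero_iff R f)
  exact
    { hasFiniteBiproducts := QuasiAbelianHearts.hasFiniteBiproducts_additiveQuotient _
      hasKernels := QuasiAbelianHearts.hasKernels_of_leftApproximations hobj hQS hS hSapp
      hasCokernels := QuasiAbelianHearts.hasCokernels_of_rightApproximations hobj hQR hR hRapp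
      cokernels_stable :=
        QuasiAbelianHearts.cokernels_isStableUnderBaseChange hobj hQR hR hRapp
      kernels_stable :=
        QuasiAbelianHearts.kernels_isStableUnderCobaseChange hobj hQS hS hSapp }
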